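/- Setting. There are finitely many agents $i\in I$ and a finite set $A$ of outcomes. $\mathcal U$ is the set of injective $u:A\to\mathbb R$ with $\min u=0$, $\max u=1$; $\mathcal R$ is the set of reflexive, complete, transitive, antisymmetric preferences on $A$; $\mathcal U(R)$ is the set of $u\in\mathcal U$ with $aRb\Leftrightarrow u(a)\ge u(b)$. A game form consists of a finite non-empty strategy set $S_i$ for each agent and an outcome function $g:\prod_i S_i\to A$. For a set $\mathbf U_i\subseteq\mathcal U$ of possible utility functions for each agent, a mechanism is a game form such that (a) no two strategies of an agent are duplicates (give the same outcome against every $s_{-i}$), and (b) every strategy of every agent $i$ is not weakly dominated for some $u_i\in\mathbf U_i$. $UD_i(u_i)$ is the set of strategies not weakly dominated by a pure or mixed strategy given $u_i$; $UD_i(R_i)$ is the set of strategies not weakly dominated by a pure strategy given the preference $R_i$. A utility belief $\mu_i$ is a Borel probability measure on $\mathbf U_{-i}=\prod_{j\ne i}\mathbf U_j$; $\mathbf M_i$ is a set of utility beliefs. A probability measure $\hat\mu_i$ on $S_{-i}$ is compatible with $\mu_i$ if it and $\mu_i$ are the marginals of a probability measure on $S_{-i}\times\mathbf U_{-i}$ that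 is concentrated on $\{(s_{-i},u_{-i}): s_j\in UD_j(u_j)\ \forall j\neq i\}$. Let $B_i(u_i,\mu_i)$ be the set of strategies in $UD_i(u_i)$ that maximize expected utility over $S_i$ for every strategic belief compatible with $\mu_i$. The game form is strategically simple if $B_i(u_i,\mu_i)\ne\emptyset$ for all $i$, $u_i\in\mathbf U_i$, $\mu_i\in\mathbf M_i$. Its outcome correspondence is $F(u,\mu)=g(\prod_i B_i(u_i,\mu_i))$ on $\prod_i\mathbf U_i\times\prod_i\mathbf M_i$; two strategically simple mechanisms are equivalent if they have the same outcome correspondence. Suppose that for every agent $i$ there is a non-empty $\mathcal R_i\subseteq\mathcal R$ with $\mathbf U_i=\bigcup_{R_i\in\mathcal R_i}\mathcal U(R_i)\neq\emptyset$, and that $\mathbf M_i$ is the set of all Borel probability measures on $\mathbf U_{-i}$. Agent $i^*$ is a local dictator at $R\in\prod_i\mathcal R_i$ if for every $s_{i^*}\in UD_{i^*}(R_{i^*})$ there is $a\in A$ with $g(s_{i^*},s_{-i^*})=a$ for all $s_{-i^*}\in\prod_{j\ne i^*}UD_j(R_j)$. A strategically simple mechanism is of type 1 if some agent is a local dictator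 at all $R\in\prod_i\mathcal R_i$. A delegation game is an extensive form in which some agent $i^*$ first chooses an element $k$ of a finite non-empty set, all agents observe $k$, and then the other agents play simultaneously a finite game form, which may depend on $k$, in which every agent $j\neq i^*$ has, for every $u_j\in\mathbf U_j$, a strategy that is optimal regardless of what the others do. A delegation mechanism is a reduced normal form of a delegation game: a game form without duplicate strategies obtained from its normal form by finitely many rounds of deleting redundant strategies, where a strategy of agent $i$ is redundant if a duplicate of it is kept or if it is weakly dominated (by a pure or mixed strategy) for every $u_i\in\mathbf U_i$. Theorem. (1) Every delegation mechanism, whether or not it satisfies (b), is a type 1 strategically simple mechanism. (2) For every type 1 strategically simple mechanism there is an equivalent delegation mechanism (one that satisfies (a) and (b)). -/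

import Mathlib

open MeasureTheory

universe v w x

namespace StrategicSimplicity

/-- Profiles of the agents other than `i`. -/
abbrev Others {I : Type v} (X : I → Type x) (i : I) : Type (max v x) :=
  ∀ j : {j : I // j ≠ i}, X j.1

/-! ### Utility functions and preferences -/

/-- The normalized utility functions without indifferences. -/
def normalizedUtilities (A : Type v) : Set (A → ℝ) :=
  {u | Function.Injective u ∧ IsLeast (Set.range u) 0 ∧ IsGreatest (Set.range u) 1}

/-- Reflexive, complete, transitive and antisymmetric preference relations. -/
structure Pref (A : Type v) where
  /-- `R.rel a b`: `a` is weakly preferred to `b`. -/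
  rel : A → A → Prop
  refl : ∀ a, rel a a
  complete : ∀ a b, rel a b ∨ rel b a
  trans : ∀ a b c, rel a b → rel b c → rel a c
  antisymm : ∀ a b, rel a b → rel b a → a = b

/-- The asymmetric part of a preference. -/
def Pref.strict {A : Type v} (R : Pref A) (a b : A) : Prop := R.rel a b ∧ ¬ R.rel b a

/-- The utility function `u` induces the preference `R`. -/
def Induces {A : Type v} (u : A → ℝ) (R : Pref A) : Prop :=
  ∀ a b, R.rel a b ↔ u b ≤ u a

/-- All normalized utility functions that induce `R`. -/
def utilitiesOf {A : Type v} (R : Pref A) : Set (A → ℝ) :=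
  {u | u ∈ normalizedUtilities A ∧ Induces u R}

/-! ### Mechanisms -/

/-- A finite game form: a finite non-empty strategy set for every agent and an outcome function. -/
structure GameForm (I : Type v) (A : Type x) where
  Strat : I → Type w
  fin : ∀ i, Fintype (Strat i)
  ne : ∀ i, Nonempty (Strat i)
  g : (∀ i, Strat i) → A

attribute [instance] GameForm.fin GameForm.ne

namespace GameForm

variable {I : Type v} [DecidableEq I] {A : Type x}

/-- Finite strategy sets carry the discrete σ-algebra. -/
instance instMeasurableSpaceStrat (M : GameForm.{v, w, x} I A) (i : I) :
    MeasurableSpace (M.Strat i) := ⊤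

/-- The outcome `g (s_i, s_{-i})`. -/
def play (M : GameForm.{v, w, x} I A) (i : I) (t : M.Strat i) (o : Others M.Strat i) : A :=
  M.g ((Equiv.piSplitAt i M.Strat).symm (t, o))

/-- There are no duplicate strategies. -/
def NoDuplicates (M : GameForm.{v, w, x} I A) : Prop :=
  ∀ (i : I) (s t : M.Strat i), s ≠ t → ∃ o : Others M.Strat i, M.play i s o ≠ M.play i t o

/-- `s` is weakly dominated by a pure or mixed strategy, given the utility function `u`. -/
def DominatedU (M : GameForm.{v, w, x} I A) (i : I) (u : A → ℝ) (s : M.Strat i) : Prop :=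
  ∃ σ ∈ stdSimplex ℝ (M.Strat i),
    (∀ o : Others M.Strat i, u (M.play i s o) ≤ ∑ t, σ t * u (M.play i t o)) ∧
    ∃ o : Others M.Strat i, u (M.play i s o) < ∑ t, σ t * u (M.play i t o)

/-- Strategies that are not weakly dominated, given a utility function. -/
def UDu (M : GameForm.{v, w, x} I A) (i : I) (u : A → ℝ) : Set (M.Strat i) :=
  {s | ¬ M.DominatedU i u s}

/-- `s` is weakly dominated by a pure strategy, given the preference `R`. -/
def DominatedR (M : GameForm.{v, w, x} I A) (i : I) (R : Pref A) (s : M.Strat i) : Prop :=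
  ∃ t : M.Strat i,
    (∀ o : Others M.Strat i, R.rel (M.play i t o) (M.play i s o)) ∧
    ∃ o : Others M.Strat i, R.strict (M.play i t o) (M.play i s o)

/-- Strategies that are not weakly dominated, given a preference. -/
def UDr (M : GameForm.{v, w, x} I A) (i : I) (R : Pref A) : Set (M.Strat i) :=
  {s | ¬ M.DominatedR i R s}

/-- Every strategy is not weakly dominated for some possible utility function of its owner. -/
def NoUselessStrategies (U : I → Set (A → ℝ)) (M : GameForm.{v, w, x} I A) : Prop :=
  ∀ (i : I) (s : M.Strat i), ∃ u ∈ U i, s ∈ M.UDu i u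

/-- All agents have, for all their possible utility functions, a strategy that is optimal
regardless of what the other agents do. -/
def IsDominantStrategyMechanism (U : I → Set (A → ℝ)) (M : GameForm.{v, w, x} I A) : Prop :=
  ∀ (i : I), ∀ u ∈ U i, ∃ s : M.Strat i, ∀ (o : Others M.Strat i) (t : M.Strat i),
    u (M.play i t o) ≤ u (M.play i s o)

end GameForm

/-! ### Beliefs, strategic simplicity and outcome correspondences -/

/-- Utility beliefs of agent `i`: Borel probability measures on the profiles of possible utility
functions of the other agents. -/
abbrev UtilityBelief {I : Type v} {A : Type x} (U : I → Set (A → ℝ)) (i : I) :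
    Type (max v x) :=
  ProbabilityMeasure (Others (fun j => ↥(U j)) i)

namespace GameForm

variable {I : Type v} [DecidableEq I] {A : Type x}

/-- Strategic beliefs of agent `i`: probability measures on `S_{-i}`. -/
abbrev StrategicBelief (M : GameForm.{v, w, x} I A) (i : I) : Type (max v w) :=
  ProbabilityMeasure (Others M.Strat i)

/-- The strategic beliefs compatible with a utility belief: there is a joint probability measure
with the two beliefs as its marginals that is concentrated on the pairs in which no other agent
plays a weakly dominated strategy. -/
def compatibleBeliefs (U : I → Set (A → ℝ)) (M : GameForm.{v, w, x} I A) (i : I)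
    (μ : UtilityBelief U i) : Set (M.StrategicBelief i) :=
  {μhat | ∃ ν : Measure (Others M.Strat i × Others (fun j => ↥(U j)) i),
    IsProbabilityMeasure ν ∧
    (∀ᵐ p ∂ν, ∀ j : {j : I // j ≠ i}, p.1 j ∈ M.UDu j.1 (p.2 j : A → ℝ)) ∧
    ν.map Prod.fst = (μhat : Measure (Others M.Strat i)) ∧
    ν.map Prod.snd = (μ : Measure (Others (fun j => ↥(U j)) i))}

/-- Expected utility of strategy `t` under a strategic belief. -/
noncomputable def expectedUtility (M : GameForm.{v, w, x} I A) (i : I) (u : A → ℝ)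
    (μhat : M.StrategicBelief i) (t : M.Strat i) : ℝ :=
  ∫ o, u (M.play i t o) ∂(μhat : Measure (Others M.Strat i))

/-- The not weakly dominated strategies that maximize expected utility among all strategies. -/
def BR (M : GameForm.{v, w, x} I A) (i : I) (u : A → ℝ) (μhat : M.StrategicBelief i) :
    Set (M.Strat i) :=
  {s | s ∈ M.UDu i u ∧ ∀ t, M.expectedUtility i u μhat t ≤ M.expectedUtility i u μhat s}

/-- The strategies that are best responses to all strategic beliefs compatible with `μ`. -/
def robustBR (U : I → Set (A → ℝ)) (M : GameForm.{v, w, x} I A) (i : I) (u : A → ℝ)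
    (μ : UtilityBelief U i) : Set (M.Strat i) :=
  ⋂ μhat ∈ M.compatibleBeliefs U i μ, M.BR i u μhat

/-- Strategic simplicity with respect to the utility domain `U` and the belief domain `B`. -/
def StrategicallySimple (U : I → Set (A → ℝ)) (B : ∀ i, Set (UtilityBelief U i))
    (M : GameForm.{v, w, x} I A) : Prop :=
  ∀ (i : I), ∀ u ∈ U i, ∀ μ ∈ B i, (M.robustBR U i u μ).Nonempty

/-- The outcome correspondence. -/
def outcomes (U : I → Set (A → ℝ)) (M : GameForm.{v, w, x} I A)
    (u : ∀ i, ↥(U i)) (μ : ∀ i, UtilityBelief U i) : Set A :=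
  M.g '' {s | ∀ i, s i ∈ M.robustBR U i (u i : A → ℝ) (μ i)}

/-- Equivalence of two strategically simple mechanisms: equal outcome correspondences. -/
def Equivalent (U : I → Set (A → ℝ)) (B : ∀ i, Set (UtilityBelief U i))
    (M N : GameForm.{v, w, x} I A) : Prop :=
  M.StrategicallySimple U B ∧ N.StrategicallySimple U B ∧
    ∀ (u : ∀ i, ↥(U i)) (μ : ∀ i, UtilityBelief U i), (∀ i, μ i ∈ B i) →
      M.outcomes U u μ = N.outcomes U u μ

/-! ### Local dictators and type 1 mechanisms -/

/-- The set of local dictators at the preference profile `R`. -/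
def localDictators (M : GameForm.{v, w, x} I A) (R : I → Pref A) : Set I :=
  {d | ∀ s ∈ M.UDr d (R d), ∃ a : A, ∀ o : Others M.Strat d,
    (∀ j : {j : I // j ≠ d}, o j ∈ M.UDr j.1 (R j.1)) → M.play d s o = a}

/-- Type 1 strategically simple mechanisms: some agent is local dictator at all profiles. -/
def IsType1 (U : I → Set (A → ℝ)) (B : ∀ i, Set (UtilityBelief U i)) (P : I → Set (Pref A))
    (M : GameForm.{v, w, x} I A) : Prop :=
  M.StrategicallySimple U B ∧
    (⋂ R ∈ {R : I → Pref A | ∀ i, R i ∈ P i}, M.localDictators R).Nonempty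

end GameForm

/-! ### Delegation mechanisms -/

/-- The extensive form: the delegate picks an element of a finite set, the pick is observed, and
the other agents play the game form attached to it. -/
structure DelegationGame (I : Type v) (A : Type x) where
  delegate : I
  Choice : Type w
  finChoice : Fintype Choice
  neChoice : Nonempty Choice
  sub : Choice → GameForm.{v, w, x} {j : I // j ≠ delegate} A

attribute [instance] DelegationGame.finChoice DelegationGame.neChoice

namespace DelegationGame

variable {I : Type v} [DecidableEq I] {A : Type x}

/-- Pure strategies of agent `i`: a move at the root if `i` is the delegate, and for each pick of
the delegate a move in the resulting subgame if `i` is not the delegate. -/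
abbrev Plan (G : DelegationGame.{v, w, x} I A) (i : I) : Type w :=
  (i = G.delegate → G.Choice) × (∀ (k : G.Choice) (h : i ≠ G.delegate), (G.sub k).Strat ⟨i, h⟩)

/-- The normal form of the extensive form. -/
noncomputable def normalForm (G : DelegationGame.{v, w, x} I A) : GameForm.{v, w, x} I A where
  Strat := G.Plan
  fin := fun _ => Fintype.ofFinite _
  ne := fun _ => inferInstance
  g := fun s => (G.sub ((s G.delegate).1 rfl)).g
    (fun j => (s j.1).2 ((s G.delegate).1 rfl) j.2)

/-- Every subgame is a dominant strategy mechanism for the agents other than the delegate. -/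
def HasDominantSubgames (U : I → Set (A → ℝ)) (G : DelegationGame.{v, w, x} I A) : Prop :=
  ∀ k, (G.sub k).IsDominantStrategyMechanism (fun j => U j.1)

end DelegationGame

namespace GameForm

variable {I : Type v} [DecidableEq I] {A : Type x}

/-- `N` arises from `M` by deleting redundant strategies: a strategy may be deleted only if a
duplicate of it is kept, or if it is weakly dominated for all possible utility functions. -/
def ReducesTo (U : I → Set (A → ℝ)) (M N : GameForm.{v, w, x} I A) : Prop :=
  ∃ e : ∀ i, N.Strat i → M.Strat i,
    (∀ i, Function.Injective (e i)) ∧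
    (∀ s : ∀ i, N.Strat i, N.g s = M.g (fun i => e i (s i))) ∧
    ∀ (i : I) (t : M.Strat i), (∃ u ∈ U i, t ∈ M.UDu i u) →
      ∃ s : N.Strat i, ∀ o : Others M.Strat i, M.play i (e i s) o = M.play i t o

/-- Delegation mechanisms: duplicate-free game forms obtained from the normal form of a delegation
game with dominant strategy subgames by finitely many rounds of deleting redundant strategies. -/
def IsDelegationMechanism (U : I → Set (A → ℝ)) (M : GameForm.{v, w, x} I A) : Prop :=
  M.NoDuplicates ∧ ∃ G : DelegationGame.{v, w, x} I A,
    G.HasDominantSubgames U ∧ Relation.ReflTransGen (ReducesTo U) G.normalForm M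

end GameForm

end StrategicSimplicity

/-! Both parts pass through one property, `HasDominantExcept`: everybody but one agent `d` has a
dominant strategy for each possible utility function. Utilities are injective, so an undominated
strategy of such an agent gives the same outcomes as the dominant one, and equals it when there are
no duplicates.

The property yields type 1: the others' behaviour is then a function of their utilities, so `d` has
at most one compatible belief per utility belief, and at each preference profile faces a single
profile of undominated strategies. Delegation games have the property by design, and reductions
preserve it.

Conversely (`StrategicallySimple.hasDominantExcept`), let `j ≠ d` and fix a profile `o` of the
others. By (b), `o` is undominated at some utility profile; under the point belief there, a robust
best response of `j` is optimal against `o`. Local dictatorship of `d` gives all undominated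
strategies of `j` the same outcome against `o`, so each is optimal there. Finally, a duplicate-free
game form with the property is itself a reduction of the game in which `d` commits first
(`HasDominantExcept.isDelegationMechanism`). -/

namespace StrategicSimplicity

namespace GameForm

variable {I : Type v} [DecidableEq I] {A : Type x} (M : GameForm.{v, w, x} I A)

/-- The strategy `s` is optimal for the utility function `u` regardless of what the others do. -/
def IsDominant (i : I) (u : A → ℝ) (s : M.Strat i) : Prop :=
  ∀ (o : Others M.Strat i) (t : M.Strat i), u (M.play i t o) ≤ u (M.play i s o)

/-- All agents other than `d` have a dominant strategy for each of their utility functions. -/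
def HasDominantExcept (U : I → Set (A → ℝ)) (d : I) : Prop :=
  ∀ j ≠ d, ∀ u ∈ U j, ∃ s, M.IsDominant j u s

variable {M}

theorem play_restrict (i : I) (s : ∀ i, M.Strat i) :
    M.play i (s i) (fun j => s j.1) = M.g s :=
  congrArg M.g ((Equiv.piSplitAt i M.Strat).symm_apply_apply s)

theorem exists_profile (i : I) (t : M.Strat i) (o : Others M.Strat i) :
    ∃ s : ∀ i, M.Strat i, s i = t ∧ (fun j : {j // j ≠ i} => s j.1) = o := by
  have h := (Equiv.piSplitAt i M.Strat).apply_symm_apply (t, o)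
  exact ⟨(Equiv.piSplitAt i M.Strat).symm (t, o), congrArg Prod.fst h, congrArg Prod.snd h⟩

/-! ### Dominant and undominated strategies -/

theorem dominatedU_of_pure {i : I} {u : A → ℝ} {s t : M.Strat i}
    (h : ∀ o, u (M.play i s o) ≤ u (M.play i t o))
    (h' : ∃ o, u (M.play i s o) < u (M.play i t o)) : M.DominatedU i u s := by
  classical
  have key : ∀ o : Others M.Strat i,
      ∑ r, (Pi.single t 1 : M.Strat i → ℝ) r * u (M.play i r o) = u (M.play i t o) := by
    intro o
    simp [Pi.single_apply]
  refine ⟨Pi.single t 1, single_mem_stdSimplex ℝ t, fun o => ?_, ?_⟩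
  · rw [key]
    exact h o
  · obtain ⟨o, ho⟩ := h'
    exact ⟨o, by rwa [key]⟩

theorem IsDominant.mem_UDu {i : I} {u : A → ℝ} {s : M.Strat i} (hs : M.IsDominant i u s) :
    s ∈ M.UDu i u := by
  rintro ⟨σ, ⟨hσ, hσ1⟩, -, o, ho⟩
  have : ∑ t, σ t * u (M.play i t o) ≤ ∑ t, σ t * u (M.play i s o) :=
    Finset.sum_le_sum fun t _ => mul_le_mul_of_nonneg_left (hs o t) (hσ t)
  rw [← Finset.sum_mul, hσ1, one_mul] at this
  exact absurd ho this.not_gt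

theorem IsDominant.play_eq_of_mem_UDu {i : I} {u : A → ℝ} (hu : Function.Injective u)
    {s t : M.Strat i} (hs : M.IsDominant i u s) (ht : t ∈ M.UDu i u) (o : Others M.Strat i) :
    M.play i t o = M.play i s o := by
  by_contra hne
  exact ht (dominatedU_of_pure (fun o => hs o t) ⟨o, lt_of_le_of_ne (hs o t) (hu.ne hne)⟩)

theorem UDu_subset_UDr {i : I} {u : A → ℝ} {R : Pref A} (hR : Induces u R) :
    M.UDu i u ⊆ M.UDr i R := by
  rintro s hs ⟨t, h, o, ho⟩
  refine hs (dominatedU_of_pure (t := t) (fun o => (hR _ _).1 (h o)) ⟨o, ?_⟩)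
  exact not_le.1 fun hle => ho.2 ((hR _ _).2 hle)

/-- If `t` fell short of the dominant `s` anywhere, `s` alone would dominate it ordinally; so `t` is
dominant too. -/
theorem IsDominant.mem_UDu_of_mem_UDr {i : I} {u : A → ℝ} {R : Pref A}
    (hR : Induces u R) {s t : M.Strat i} (hs : M.IsDominant i u s) (ht : t ∈ M.UDr i R) :
    t ∈ M.UDu i u := by
  refine IsDominant.mem_UDu fun o r => (hs o r).trans ?_
  by_contra hlt
  exact ht ⟨s, fun o => (hR _ _).2 (hs o t), o, (hR _ _).2 (hs o t), fun h => hlt ((hR _ _).1 h)⟩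

theorem NoDuplicates.eq_of_mem_UDu (hM : M.NoDuplicates) {i : I} {u : A → ℝ}
    (hu : Function.Injective u) {s t : M.Strat i} (hs : M.IsDominant i u s)
    (ht : t ∈ M.UDu i u) : t = s := by
  by_contra hne
  obtain ⟨o, ho⟩ := hM i t s hne
  exact ho (hs.play_eq_of_mem_UDu hu ht o)

/-! ### Best responses -/

section Finite

variable [Fintype I]

theorem integrable_play (i : I) (u : A → ℝ) (μhat : M.StrategicBelief i) (t : M.Strat i) :
    Integrable (fun o => u (M.play i t o)) (μhat : Measure (Others M.Strat i)) :=
  Integrable.of_finite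

theorem BR_nonempty (i : I) (u : A → ℝ) (μhat : M.StrategicBelief i) :
    (M.BR i u μhat).Nonempty := by
  classical
  set E := M.expectedUtility i u μhat with hE
  obtain ⟨s₀, hs₀⟩ := Finite.exists_max E
  -- Ties among maximizers are broken by total utility over all profiles, which is strictly monotone
  -- under weak dominance.
  let total : M.Strat i → ℝ := fun t => ∑ o : Others M.Strat i, u (M.play i t o)
  obtain ⟨s, hs, hmax⟩ := Finset.exists_max_image
    (Finset.univ.filter fun s => E s₀ ≤ E s) total ⟨s₀, by simp⟩
  have hsE : ∀ t, E t ≤ E s := fun t => (hs₀ t).trans (Finset.mem_filter.1 hs).2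
  refine ⟨s, ?_, hsE⟩
  rintro ⟨σ, ⟨hσ, hσ1⟩, hle, o, hlt⟩
  have hEσ : E s ≤ ∑ t, σ t * E t := by
    have : ∑ t, σ t * E t =
        ∫ o, ∑ t, σ t * u (M.play i t o) ∂(μhat : Measure (Others M.Strat i)) := by
      rw [integral_finsetSum _ fun t _ => (integrable_play i u μhat t).const_mul _]
      simp only [integral_const_mul, hE, expectedUtility]
    rw [this]
    exact integral_mono (integrable_play i u μhat s) Integrable.of_finite hle
  -- A dominating mixture must put all its weight on maximizers of expected utility, among which `s`
  -- has the largest total.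
  have hsupp : ∀ t, σ t * E t = σ t * E s := by
    have hsum : ∑ t, σ t * E s = E s := by rw [← Finset.sum_mul, hσ1, one_mul]
    have hle' : ∀ t ∈ Finset.univ, σ t * E t ≤ σ t * E s := fun t _ =>
      mul_le_mul_of_nonneg_left (hsE t) (hσ t)
    have := (Finset.sum_eq_sum_iff_of_le hle').1
      (le_antisymm (Finset.sum_le_sum hle') (hsum.trans_le hEσ))
    exact fun t => this t (Finset.mem_univ t)
  have htotal : ∑ t, σ t * total t ≤ total s := by
    calc ∑ t, σ t * total t ≤ ∑ t, σ t * total s := by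
          refine Finset.sum_le_sum fun t _ => ?_
          rcases (hσ t).eq_or_lt with h0 | hpos
          · simp [← h0]
          · refine mul_le_mul_of_nonneg_left (hmax t ?_) hpos.le
            have : E t = E s := mul_left_cancel₀ hpos.ne' (hsupp t)
            simp [this, hsE s₀]
      _ = total s := by rw [← Finset.sum_mul, hσ1, one_mul]
  have hgt : total s < ∑ t, σ t * total t := by
    simp only [total, Finset.mul_sum]
    rw [Finset.sum_comm]
    exact Finset.sum_lt_sum (fun o _ => hle o) ⟨o, Finset.mem_univ o, hlt⟩
  exact absurd hgt htotal.not_gt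

theorem UDu_nonempty (i : I) (u : A → ℝ) : (M.UDu i u).Nonempty := by
  obtain ⟨s, hs⟩ := BR_nonempty (M := M) i u
    ⟨Measure.dirac (Classical.arbitrary _), inferInstance⟩
  exact ⟨s, hs.1⟩

variable {U : I → Set (A → ℝ)} {d : I}

theorem IsDominant.mem_robustBR {i : I} {u : A → ℝ} {s : M.Strat i} (hs : M.IsDominant i u s)
    (μ : UtilityBelief U i) : s ∈ M.robustBR U i u μ := by
  refine Set.mem_iInter₂.2 fun μhat _ => ⟨hs.mem_UDu, fun t => ?_⟩
  exact integral_mono (integrable_play i u μhat t) (integrable_play i u μhat s) fun o => hs o t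

theorem measurable_of_isDominant {i : I} (hU : ∀ u ∈ U i, Function.Injective u)
    (hM : M.NoDuplicates) {f : ↥(U i) → M.Strat i} (hf : ∀ u : ↥(U i), M.IsDominant i u (f u)) :
    Measurable f := by
  refine measurable_to_countable' fun s => ?_
  -- Dominant strategies are unique, so the fibre is cut out by finitely many inequalities between
  -- coordinates of `u`.
  have : f ⁻¹' {s} = {u : ↥(U i) | ∀ (o : Others M.Strat i) (t : M.Strat i),
      (u : A → ℝ) (M.play i t o) ≤ (u : A → ℝ) (M.play i s o)} := by
    ext u
    constructor
    · rintro rfl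
      exact hf u
    · intro h
      exact (hM.eq_of_mem_UDu (hU u u.2) (hf u) (IsDominant.mem_UDu h)).symm
  rw [this]
  simp only [Set.ofPred_forall]
  refine MeasurableSet.iInter fun o => MeasurableSet.iInter fun t => measurableSet_le ?_ ?_
  · exact (measurable_pi_apply _).comp measurable_subtype_coe
  · exact (measurable_pi_apply _).comp measurable_subtype_coe

/-- If all other agents have dominant strategies, then a utility belief determines the compatible
strategic belief. -/
theorem HasDominantExcept.compatibleBeliefs_subsingleton (h : M.HasDominantExcept U d)
    (hU : ∀ i, ∀ u ∈ U i, Function.Injective u) (hM : M.NoDuplicates) (μ : UtilityBelief U d) :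
    (M.compatibleBeliefs U d μ).Subsingleton := by
  choose f hf using fun (j : {j // j ≠ d}) (u : ↥(U j.1)) => h j.1 j.2 u u.2
  let F : Others (fun j => ↥(U j)) d → Others M.Strat d := fun u j => f j (u j)
  have hF : Measurable F := measurable_pi_lambda _ fun j =>
    (measurable_of_isDominant (hU j.1) hM (hf j)).comp (measurable_pi_apply j)
  have key : ∀ μhat ∈ M.compatibleBeliefs U d μ, (μhat : Measure (Others M.Strat d)) =
      (μ : Measure (Others (fun j => ↥(U j)) d)).map F := by
    rintro μhat ⟨ν, -, hν, hfst, hsnd⟩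
    rw [← hfst, ← hsnd, Measure.map_map hF measurable_snd]
    refine Measure.map_congr (hν.mono fun p hp => funext fun j => ?_)
    exact hM.eq_of_mem_UDu (hU j.1 _ (p.2 j).2) (hf j (p.2 j)) (hp j)
  exact fun μ₁ h₁ μ₂ h₂ => Subtype.ext ((key μ₁ h₁).trans (key μ₂ h₂).symm)

theorem HasDominantExcept.strategicallySimple (h : M.HasDominantExcept U d)
    (hU : ∀ i, ∀ u ∈ U i, Function.Injective u) (hM : M.NoDuplicates)
    (B : ∀ i, Set (UtilityBelief U i)) : M.StrategicallySimple U B := by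
  intro i u hu μ _
  by_cases hi : i = d
  · subst hi
    have hsub := h.compatibleBeliefs_subsingleton hU hM μ
    rcases hsub.eq_empty_or_singleton with h0 | ⟨μhat, h1⟩
    -- Without compatible beliefs the intersection is the whole strategy set.
    · simp [robustBR, h0]
    · simpa [robustBR, h1] using BR_nonempty i u μhat
  · obtain ⟨s, hs⟩ := h i hi u hu
    exact ⟨s, hs.mem_robustBR μ⟩

end Finite

/-! ### Local dictatorship from dominant strategies. -/

variable {U : I → Set (A → ℝ)} {d : I}

theorem HasDominantExcept.mem_localDictators (h : M.HasDominantExcept U d)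
    (hU : ∀ i, ∀ u ∈ U i, Function.Injective u) (hM : M.NoDuplicates) {R : I → Pref A}
    (hR : ∀ i, ∃ u ∈ U i, Induces u (R i)) : d ∈ M.localDictators R := by
  choose u hu hind using hR
  choose f hf using fun j : {j // j ≠ d} => h j.1 j.2 (u j.1) (hu j.1)
  refine fun s _ => ⟨M.play d s f, fun o ho => congrArg _ (funext fun j => ?_)⟩
  exact hM.eq_of_mem_UDu (hU j.1 _ (hu j.1)) (hf j)
    ((hf j).mem_UDu_of_mem_UDr (hind j.1) (ho j))

/-! ### Reductions -/

theorem ReducesTo.play_eq {N : GameForm.{v, w, x} I A} {e : ∀ i, N.Strat i → M.Strat i}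
    (he : ∀ s : ∀ i, N.Strat i, N.g s = M.g (fun i => e i (s i))) (i : I) (t : N.Strat i)
    (o : Others N.Strat i) : N.play i t o = M.play i (e i t) (fun j => e j.1 (o j)) := by
  obtain ⟨s, rfl, rfl⟩ := exists_profile i t o
  rw [play_restrict, he, ← play_restrict i]

/-- A dominant strategy is undominated, so a strategy with the same outcomes is kept, and it stays
optimal after other strategies are deleted. -/
theorem HasDominantExcept.of_reducesTo {N : GameForm.{v, w, x} I A}
    (h : M.HasDominantExcept U d) (hMN : M.ReducesTo U N) : N.HasDominantExcept U d := by
  obtain ⟨e, -, he, hkeep⟩ := hMN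
  intro j hj u hu
  obtain ⟨t, ht⟩ := h j hj u hu
  obtain ⟨s, hs⟩ := hkeep j t ⟨u, hu, ht.mem_UDu⟩
  refine ⟨s, fun o r => ?_⟩
  rw [ReducesTo.play_eq he, ReducesTo.play_eq he, hs]
  exact ht _ _

theorem HasDominantExcept.of_reflTransGen {N : GameForm.{v, w, x} I A}
    (h : M.HasDominantExcept U d) (hMN : Relation.ReflTransGen (ReducesTo U) M N) :
    N.HasDominantExcept U d := by
  induction hMN with
  | refl => exact h
  | tail _ hstep ih => exact ih.of_reducesTo hstep

end GameForm

/-! ### Normal forms of delegation games -/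

namespace DelegationGame

variable {I : Type v} [DecidableEq I] {A : Type x} {U : I → Set (A → ℝ)}
  {G : DelegationGame.{v, w, x} I A}

theorem normalForm_play {j : I} (hj : j ≠ G.delegate) (t : G.Plan j)
    (o : Others G.Plan j) :
    G.normalForm.play j t o =
      (G.sub ((o ⟨G.delegate, hj.symm⟩).1 rfl)).play ⟨j, hj⟩
        (t.2 ((o ⟨G.delegate, hj.symm⟩).1 rfl) hj)
        (fun l => (o ⟨l.1.1, fun h => l.2 (Subtype.ext h)⟩).2
          ((o ⟨G.delegate, hj.symm⟩).1 rfl) l.1.2) := by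
  obtain ⟨s, rfl, rfl⟩ := GameForm.exists_profile (M := G.normalForm) j t o
  exact (GameForm.play_restrict (M := G.normalForm) j s).trans
    (GameForm.play_restrict (M := G.sub ((s G.delegate).1 rfl)) ⟨j, hj⟩
      fun l => (s l.1).2 ((s G.delegate).1 rfl) l.2).symm

theorem isDominant_normalForm {j : I} (hj : j ≠ G.delegate) {u : A → ℝ} {s : G.Plan j}
    (hs : ∀ k, (G.sub k).IsDominant ⟨j, hj⟩ u (s.2 k hj)) : G.normalForm.IsDominant j u s := by
  intro o t
  exact (congrArg u (normalForm_play hj t o)).trans_le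
    ((hs _ _ _).trans_eq (congrArg u (normalForm_play hj s o)).symm)

theorem HasDominantSubgames.hasDominantExcept (hG : G.HasDominantSubgames U) :
    G.normalForm.HasDominantExcept U G.delegate := by
  intro j hj u hu
  choose f hf using fun k => hG k ⟨j, hj⟩ u hu
  exact ⟨⟨fun h => absurd h hj, fun k _ => f k⟩, isDominant_normalForm hj hf⟩

end DelegationGame

namespace GameForm

variable {I : Type v} [DecidableEq I] {A : Type x} {M : GameForm.{v, w, x} I A}
  {U : I → Set (A → ℝ)} {d : I}

/-! ### Mechanisms as delegation mechanisms -/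

/-- The game in which `d` publicly commits to a strategy before the other agents move. -/
def commitmentGame (M : GameForm.{v, w, x} I A) (d : I) : DelegationGame.{v, w, x} I A where
  delegate := d
  Choice := M.Strat d
  finChoice := inferInstance
  neChoice := inferInstance
  sub k :=
    { Strat := fun j => M.Strat j.1
      fin := fun _ => inferInstance
      ne := fun _ => inferInstance
      g := M.play d k }

theorem IsDominant.commitmentGame {j : I} (hj : j ≠ d) {u : A → ℝ} {s : M.Strat j}
    (hs : M.IsDominant j u s) (k : M.Strat d) :
    ((M.commitmentGame d).sub k).IsDominant ⟨j, hj⟩ u s := by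
  intro o t
  -- The subgame profile, completed by the commitment `k` of `d`.
  let o' : Others M.Strat j := fun l =>
    if h : l.1 = d then h.symm ▸ k else o ⟨⟨l.1, h⟩, fun h' => l.2 (congrArg Subtype.val h')⟩
  have key : ∀ t : M.Strat j,
      ((M.commitmentGame d).sub k).play ⟨j, hj⟩ t o = M.play j t o' := by
    intro t
    refine congrArg M.g (funext fun l => ?_)
    by_cases hl : l = d
    · subst hl
      simp [o', Equiv.piSplitAt, hj.symm]
    · by_cases hlj : l = j
      · subst hlj
        exact ((dif_neg hl).trans (dif_pos rfl)).trans (dif_pos rfl).symm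
      · have hne : (⟨l, hl⟩ : {l // l ≠ d}) ≠ ⟨j, hj⟩ := fun h => hlj (congrArg Subtype.val h)
        exact ((dif_neg hl).trans (dif_neg hne)).trans ((dif_neg hlj).trans (dif_neg hl)).symm
  exact (congrArg u (key t)).trans_le ((hs o' t).trans_eq (congrArg u (key s)).symm)

theorem HasDominantExcept.isDelegationMechanism (h : M.HasDominantExcept U d)
    (hU : ∀ i, ∀ u ∈ U i, Function.Injective u) (hM : M.NoDuplicates) :
    M.IsDelegationMechanism U := by
  refine ⟨hM, M.commitmentGame d, ?_, Relation.ReflTransGen.single ?_⟩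
  · rintro k ⟨j, hj⟩ u hu
    obtain ⟨s, hs⟩ := h j hj u hu
    exact ⟨s, hs.commitmentGame hj k⟩
  -- Agents other than `d` ignore the observed commitment.
  · let e : ∀ i, M.Strat i → (M.commitmentGame d).Plan i := fun i s =>
      ⟨fun h => cast (congrArg M.Strat h) s, fun _ _ => s⟩
    refine ⟨e, fun i s t hst => ?_, fun s => ?_, ?_⟩
    · by_cases hi : i = d
      · subst hi
        exact congrFun (congrArg Prod.fst hst) rfl
      · exact congrFun (congrFun (congrArg Prod.snd hst) (Classical.arbitrary (M.Strat d))) hi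
    · exact (play_restrict d s).symm
    · rintro i t ⟨u, hu, ht⟩
      by_cases hi : i = d
      · subst hi
        have het : e i (t.1 rfl) = t :=
          Prod.ext rfl (funext fun _ => funext fun h => absurd rfl h)
        exact ⟨t.1 rfl, fun o => by rw [het]⟩
      · obtain ⟨s, hs⟩ := h i hi u hu
        have hes : (M.commitmentGame d).normalForm.IsDominant i u (e i s) :=
          -- The constant plan is dominant, so every undominated plan has the same outcomes.
          DelegationGame.isDominant_normalForm hi fun k => hs.commitmentGame hi k
        exact ⟨s, fun o => (hes.play_eq_of_mem_UDu (hU i u hu) ht o).symm⟩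

/-! ### Type 1 mechanisms -/

section Type1

variable [Fintype I] {P : I → Set (Pref A)}

theorem dirac_mem_compatibleBeliefs (i : I) (v : Others (fun j => ↥(U j)) i)
    (o : Others M.Strat i) (ho : ∀ j, o j ∈ M.UDu j.1 (v j : A → ℝ)) [Finite A] :
    (⟨Measure.dirac o, inferInstance⟩ : M.StrategicBelief i) ∈
      M.compatibleBeliefs U i ⟨Measure.dirac v, inferInstance⟩ := by
  refine ⟨Measure.dirac (o, v), inferInstance, ?_, ?_, ?_⟩
  · rw [ae_dirac_eq]
    exact ho
  · exact Measure.map_dirac' measurable_fst _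
  · exact Measure.map_dirac' measurable_snd _

theorem StrategicallySimple.hasDominantExcept [Finite A]
    (hS : M.StrategicallySimple U fun _ => Set.univ) (hM : M.NoUselessStrategies U)
    (hU : ∀ i, ∀ u ∈ U i, ∃ R ∈ P i, Induces u R)
    (hd : ∀ R : I → Pref A, (∀ i, R i ∈ P i) → d ∈ M.localDictators R) :
    M.HasDominantExcept U d := by
  intro j hj u hu
  obtain ⟨s, hs⟩ := UDu_nonempty (M := M) j u
  refine ⟨s, fun o t => ?_⟩
  -- Condition (b) makes `o` a possible behaviour, so certainty of `o` is compatible with certainty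
  -- of `v`.
  choose v hvU hv using fun l : {l // l ≠ j} => hM l.1 (o l)
  obtain ⟨r, hr⟩ := hS j u hu
    ⟨Measure.dirac fun l => ⟨v l, hvU l⟩, inferInstance⟩ (Set.mem_univ _)
  have hBR := Set.mem_iInter₂.1 hr _ (dirac_mem_compatibleBeliefs j _ o hv)
  have hrt : u (M.play j t o) ≤ u (M.play j r o) := by
    simpa [expectedUtility] using hBR.2 t
  have hrs : M.play j r o = M.play j s o := by
    obtain ⟨Rj, hRj, hindj⟩ := hU j u hu
    choose R hR hind using fun l : {l // l ≠ j} => hU l.1 (v l) (hvU l)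
    let S : I → Pref A := fun l => if h : l = j then Rj else R ⟨l, h⟩
    have hSj : S j = Rj := dif_pos rfl
    have hSl : ∀ l : {l // l ≠ j}, S l.1 = R l := fun l => dif_neg l.2
    have hSP : ∀ l, S l ∈ P l := by
      intro l
      by_cases h : l = j
      · subst h
        rwa [hSj]
      · rw [hSl ⟨l, h⟩]
        exact hR ⟨l, h⟩
    have ho : ∀ l : {l // l ≠ j}, o l ∈ M.UDr l.1 (S l.1) := by
      intro l
      rw [hSl l]
      exact UDu_subset_UDr (hind l) (hv l)
    obtain ⟨a, ha⟩ := hd S hSP (o ⟨d, hj.symm⟩) (ho ⟨d, hj.symm⟩)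
    -- At `S`, replacing the strategy of `j` by any undominated one leaves the outcome picked by `d`
    -- unchanged.
    have key : ∀ q ∈ M.UDu j u, M.play j q o = a := by
      intro q hq
      obtain ⟨p, hpq, hpo⟩ := exists_profile j q o
      have hpd : p d = o ⟨d, hj.symm⟩ := congrFun hpo ⟨d, hj.symm⟩
      rw [← hpq, ← hpo, play_restrict, ← play_restrict d, hpd]
      refine ha _ fun l => ?_
      by_cases h : l.1 = j
      · rw [h, hpq, hSj]
        exact UDu_subset_UDr hindj hq
      · have := ho ⟨l.1, h⟩
        rwa [← congrFun hpo ⟨l.1, h⟩] at this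
    rw [key r hBR.1, key s hs]
  rwa [← hrs]

end Type1

end GameForm

/-! ### Existence of utility representations -/

/-- Local dictatorship concerns every preference in the domain, so each must come from a utility
function: count the outcomes weakly below and rescale to `[0, 1]`. -/
theorem utilitiesOf_nonempty {A : Type x} [Fintype A] [Nontrivial A] (R : Pref A) :
    (utilitiesOf R).Nonempty := by
  classical
  let f : A → ℕ := fun a => (Finset.univ.filter fun b => R.rel a b).card
  have hlt : ∀ a b, ¬ R.rel b a → f b < f a := by
    intro a b hba
    have hab := (R.complete a b).resolve_right hba
    refine Finset.card_lt_card (Finset.ssubset_iff_of_subset ?_ |>.2 ⟨a, ?_, ?_⟩)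
    · exact fun c hc => by simpa using R.trans a b c hab (by simpa using hc)
    · simpa using R.refl a
    · simpa using hba
  have hf : ∀ a b, R.rel a b ↔ f b ≤ f a := by
    refine fun a b => ⟨fun hab => ?_, fun h => by_contra fun hab => (hlt b a hab).not_ge h⟩
    by_cases hba : R.rel b a
    · rw [R.antisymm a b hab hba]
    · exact (hlt a b hba).le
  have hinj : Function.Injective f := fun a b h =>
    R.antisymm a b ((hf a b).2 h.ge) ((hf b a).2 h.le)
  obtain ⟨m, hm⟩ := Finite.exists_min f
  obtain ⟨t, ht⟩ := Finite.exists_max f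
  obtain ⟨p, q, hpq⟩ := exists_pair_ne A
  have hmt : f m < f t := by
    rcases (hinj.ne hpq).lt_or_gt with h | h
    · exact (hm p).trans_lt (h.trans_le (ht q))
    · exact (hm q).trans_lt (h.trans_le (ht p))
  have hpos : (0 : ℝ) < f t - f m := sub_pos.2 (by exact_mod_cast hmt)
  have hle : ∀ a b, ((f b : ℝ) - f m) / (f t - f m) ≤ ((f a : ℝ) - f m) / (f t - f m) ↔
      f b ≤ f a := by
    intro a b
    rw [div_le_div_iff_of_pos_right hpos, sub_le_sub_iff_right, Nat.cast_le]
  refine ⟨fun a => (f a - f m) / (f t - f m), ⟨fun a b h => ?_, ⟨⟨m, by simp⟩, ?_⟩,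
    ⟨t, div_self hpos.ne'⟩, ?_⟩, fun a b => (hf a b).trans (hle a b).symm⟩
  · exact hinj (le_antisymm ((hle b a).1 h.le) ((hle a b).1 h.ge))
  · rintro _ ⟨a, rfl⟩
    exact div_nonneg (sub_nonneg.2 (by exact_mod_cast hm a)) hpos.le
  · rintro _ ⟨a, rfl⟩
    exact (div_le_one hpos).2 (sub_le_sub_right (by exact_mod_cast ht a) _)

theorem nontrivial_of_mem_normalizedUtilities {A : Type x} {u : A → ℝ}
    (hu : u ∈ normalizedUtilities A) : Nontrivial A := by
  obtain ⟨-, ⟨⟨a, ha⟩, -⟩, ⟨b, hb⟩, -⟩ := hu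
  refine ⟨a, b, ?_⟩
  rintro rfl
  exact zero_ne_one (ha.symm.trans hb)

end StrategicSimplicity

/-! ### Type 1 and delegation mechanisms. -/

theorem theorem2 {I : Type v} [Fintype I] [DecidableEq I] {A : Type x} [Fintype A]
    (P : I → Set (StrategicSimplicity.Pref A)) (hP : ∀ i, (P i).Nonempty)
    (U : I → Set (A → ℝ)) (hUne : ∀ i, (U i).Nonempty)
    (hU : ∀ i, U i = ⋃ R ∈ P i, StrategicSimplicity.utilitiesOf R)
    (B : ∀ i, Set (StrategicSimplicity.UtilityBelief U i)) (hB : ∀ i, B i = Set.univ) :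
    (∀ M : StrategicSimplicity.GameForm.{v, w, x} I A,
      M.IsDelegationMechanism U → M.IsType1 U B P) ∧
    (∀ M : StrategicSimplicity.GameForm.{v, w, x} I A,
      M.NoDuplicates → M.NoUselessStrategies U → M.IsType1 U B P →
        ∃ D : StrategicSimplicity.GameForm.{v, w, x} I A,
          D.IsDelegationMechanism U ∧ D.NoUselessStrategies U ∧
            StrategicSimplicity.GameForm.Equivalent U B D M) := by
  have hmem : ∀ i, ∀ u ∈ U i, ∃ R ∈ P i, u ∈ StrategicSimplicity.utilitiesOf R := by
    intro i u hu
    rw [hU i] at hu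
    simpa using hu
  have hinj : ∀ i, ∀ u ∈ U i, Function.Injective u := by
    intro i u hu
    obtain ⟨R, -, hR⟩ := hmem i u hu
    exact hR.1.1
  refine ⟨fun M hM => ?_, fun M hdup huse hM => ?_⟩
  · obtain ⟨hdup, G, hG, hred⟩ := hM
    have h := hG.hasDominantExcept.of_reflTransGen hred
    refine ⟨h.strategicallySimple hinj hdup B, G.delegate, Set.mem_iInter₂.2 fun R hR => ?_⟩
    refine h.mem_localDictators hinj hdup fun i => ?_
    obtain ⟨v, hv⟩ := hUne i
    obtain ⟨R', -, hR'⟩ := hmem i v hv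
    have := StrategicSimplicity.nontrivial_of_mem_normalizedUtilities hR'.1
    obtain ⟨u, hu⟩ := StrategicSimplicity.utilitiesOf_nonempty (R i)
    refine ⟨u, ?_, hu.2⟩
    rw [hU i]
    exact Set.mem_biUnion (hR i) hu
  · obtain ⟨hS, d, hd⟩ := hM
    obtain rfl : B = fun _ => Set.univ := funext hB
    have h : M.HasDominantExcept U d := hS.hasDominantExcept (P := P) huse
      (fun i u hu => (hmem i u hu).imp fun R hR => ⟨hR.1, hR.2.2⟩)
      fun R hR => Set.mem_iInter₂.1 hd R hR
    exact ⟨M, h.isDelegationMechanism hinj hdup, huse, hS, hS, fun _ _ _ => rfl⟩
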